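/- Let $\Omega=\{q\in\mathbb R^2:\|q\|<1\}$ and let $b$ be a magnetic field that is locally Lipschitz on an open neighbourhood $U$ of $\overline\Omega$ and radial on the disc, $b(q)=B(\|q\|)$ for $\|q\|\le 1$. A trajectory is a solution of Newton's equation $\ddot q_1=b(q)\,\dot q_2$, $\ddot q_2=-b(q)\,\dot q_1$. Consider the trajectory starting at time $0$ at a point $q(0)$ with $\|q(0)\|=1$, with velocity $\dot q(0)=v_1\neq 0$, and let $v_r=\langle q(0),v_1\rangle$ and $v_\theta=\det(q(0),v_1)$ be the radial and tangential components of $v_1$. Assume that it enters $\Omega$, in the sense that either $v_r<0$, or $v_r=0$ and $B(1)/v_\theta<-1$. Put \[ G(r)=\int_0^r\tau B(\tau)\,d\tau,\qquad p_\theta=v_\theta+G(1),\qquad H_0=\tfrac12\|v_1\|^2,\qquad V(r)=\frac{(p_\theta-G(r))^2}{2r^2}\quad(r>0), \] and let $\gamma$ be the oriented angle from the outward normal $q(0)$ to $v_1$. Assume that (i) either the equation $V(r)=H_0$ has a solution in $(0,1)$ and the solution $r^*$ in $(0,1)$ closest to $1$ satisfies $V'(r^*)<0$, (ii) or $p_\theta=0$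 and the equation $V(r)=H_0$ has no solution in $(0,1)$. Then the trajectory escapes from $\Omega$ in finite time: it exists, and is the unique trajectory with its initial data, on an interval $[0,T]$ with $0<T<\infty$, where $\|q(t)\|<1$ for $0<t<T$ and $\|q(T)\|=1$, and the straight half-line $q(T)+s v_2$, $s>0$, with $v_2=\dot q(T)$, does not meet $\overline\Omega$. Moreover $\|v_2\|=\|v_1\|$, and the oriented angle $\omega\in(-\pi,\pi]$ from $v_1$ to $v_2$ is given modulo $2\pi$ as follows. In case (i) the trajectory does not pass through the origin during $[0,T]$, and \[ \omega\equiv\alpha+\pi-2\gamma,\qquad \alpha=2\int_{r^*}^1\frac{p_\theta-G(r)}{r\sqrt{2H_0r^2-(p_\theta-G(r))^2}}\,dr . \] In case (ii) the trajectory passes through the origin during $(0,T)$, and \[ \omega\equiv\alpha-2\gamma,\qquad \alpha=2\int_0^1\frac{-G(r)}{r\sqrt{2H_0r^2-G(r)^2}}\,dr . \] In both cases the integral converges absolutely. -/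

import Mathlib

noncomputable section

namespace MagneticScattering

/-- `(q, v)` is a solution on `[0, T]`, with position `q` in `U`, of Newton's equation
`q'' = q' × (0, 0, b(q))`, that is `q₁'' = b(q) q₂'`, `q₂'' = -b(q) q₁'`, where the plane is
identified with `ℂ`, so that the Lorentz force is `-i b(q) q'`. -/
structure IsTrajectoryOn (b : ℂ → ℝ) (U : Set ℂ) (T : ℝ) (q v : ℝ → ℂ) : Prop where
  mem : ∀ t ∈ Set.Icc 0 T, q t ∈ U
  velocity : ∀ t ∈ Set.Icc 0 T, HasDerivWithinAt q (v t) (Set.Icc 0 T) t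
  newton : ∀ t ∈ Set.Icc 0 T,
    HasDerivWithinAt v (-Complex.I * (b (q t) : ℂ) * v t) (Set.Icc 0 T) t

/-- Radial component of the velocity `v` at the point `q ≠ 0`. -/
def radialVelocity (q v : ℂ) : ℝ := (starRingEnd ℂ q * v).re / ‖q‖

/-- Tangential (counterclockwise) component of the velocity `v` at the point `q ≠ 0`. -/
def tangentialVelocity (q v : ℂ) : ℝ := (starRingEnd ℂ q * v).im / ‖q‖

/-- `G(r) = ∫₀ʳ τ B(τ) dτ`. -/
def G (B : ℝ → ℝ) (r : ℝ) : ℝ := ∫ τ in (0 : ℝ)..r, τ * B τ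

/-- The canonical angular momentum `p_θ = r v_θ + G(r)`. -/
def angularMomentum (B : ℝ → ℝ) (q v : ℂ) : ℝ :=
  ‖q‖ * tangentialVelocity q v + G B ‖q‖

/-- The energy `H₀ = ‖v‖² / 2`. -/
def energy (v : ℂ) : ℝ := ‖v‖ ^ 2 / 2

/-- The effective radial potential `V(r) = (p_θ - G(r))² / (2 r²)`. -/
def V (B : ℝ → ℝ) (p : ℝ) (r : ℝ) : ℝ := (p - G B r) ^ 2 / (2 * r ^ 2)

/-- `r` is the solution of `V = H₀` in `(0, 1)` that is closest to `1`. -/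
def IsOutermostTurningPoint (B : ℝ → ℝ) (p H₀ r : ℝ) : Prop :=
  IsGreatest {r : ℝ | r ∈ Set.Ioo (0 : ℝ) 1 ∧ V B p r = H₀} r

/-- The integrand `(p_θ - G(r)) / (r √(2 H₀ r² - (p_θ - G(r))²))`. -/
def angleIntegrand (B : ℝ → ℝ) (p H₀ r : ℝ) : ℝ :=
  (p - G B r) / (r * Real.sqrt (2 * H₀ * r ^ 2 - (p - G B r) ^ 2))

/-- The curve `q`, with velocity `v`, crosses the open unit disc during `(0, T)` and is at time
`T` on the unit circle; the free (straight) motion that continues it outside the disc never meets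
the closed disc again. -/
structure EscapesAt (q v : ℝ → ℂ) (T : ℝ) : Prop where
  pos : 0 < T
  inside : ∀ t ∈ Set.Ioo 0 T, ‖q t‖ < 1
  boundary : ‖q T‖ = 1
  leaves : ∀ s : ℝ, 0 < s → 1 < ‖q T + s * v T‖

/-- The oriented angle from `w` to `z`, with value in `(-π, π]`. -/
def orientedAngle (w z : ℂ) : ℝ := Complex.arg (starRingEnd ℂ w * z)

end MagneticScattering

end

/-!
In terms of the squared radius `x = ‖q‖²` the radial motion is regular even at the origin:
`(x' / 2)² = P(x)` and `x'' / 2 = P'(x)`, where `P(r²) = 2 r² (H₀ - V(r))`. The hypotheses say that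
the largest zero of `P` below `1` is simple, with `P' > 0` there; it is `r*²` in case (i) and `0` in
case (ii). A trajectory that enters the disc falls to this zero in finite time, since an endless
fall would converge to it, against the force `P' > 0`. There the velocity is perpendicular to the
position, and a reflection in a line through the origin combined with time reversal preserves
Newton's equation in a radial field, so that the way out is the mirror image of the way in.

The deflection follows from the angle `∫ (dθ/dr) dr` swept by the position on the way in. In case
(ii) the angular velocity stays continuous up to the origin, and the angle formula, written for the
square of the velocity, passes to the limit.
-/

open Set Filter Topology MeasureTheory
open scoped NNReal ComplexConjugate

namespace MagneticScattering

section GlobalFlow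

variable {E : Type*} [NormedAddCommGroup E] [NormedSpace ℝ E] [CompleteSpace E]
  {F : E → E} {K M : ℝ≥0}

theorem exists_isIntegralCurveOn_Ioo_of_lipschitzWith (hF : LipschitzWith K F)
    (hM : ∀ x, ‖F x‖ ≤ M) (x₀ : E) (r : ℝ) :
    ∃ f : ℝ → E, f 0 = x₀ ∧ IsIntegralCurveOn f (fun _ ↦ F) (Ioo (-r) r) := by
  have hmem : (0 : ℝ) ∈ Icc (-|r|) |r| := by simp
  have hPL : IsPicardLindelof (fun _ ↦ F) (⟨0, hmem⟩ : Icc (-|r|) |r|) x₀ (M * ‖r‖₊) 0 M K :=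
    IsPicardLindelof.of_time_independent (fun x _ ↦ hM x) hF.lipschitzOnWith (by simp)
  obtain ⟨f, hf₀, hf⟩ := hPL.exists_eq_forall_mem_Icc_hasDerivWithinAt₀
  have hsub : Ioo (-r) r ⊆ Icc (-|r|) |r| :=
    Ioo_subset_Icc_self.trans (Icc_subset_Icc (neg_le_neg (le_abs_self r)) (le_abs_self r))
  exact ⟨f, hf₀, fun t ht ↦ (hf t (hsub ht)).mono hsub⟩

theorem exists_isIntegralCurve_of_lipschitzWith (hF : LipschitzWith K F) (hM : ∀ x, ‖F x‖ ≤ M)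
    (x₀ : E) : ∃ f : ℝ → E, f 0 = x₀ ∧ IsIntegralCurve f fun _ ↦ F := by
  choose f hf₀ hf using exists_isIntegralCurveOn_Ioo_of_lipschitzWith hF hM x₀
  have hd (r t : ℝ) (ht : |t| < r) : HasDerivAt (f r) (F (f r t)) t :=
    (hf r t (abs_lt.1 ht)).hasDerivAt (Ioo_mem_nhds (abs_lt.1 ht).1 (abs_lt.1 ht).2)
  have agree (r r' t : ℝ) (ht : |t| < r) (ht' : |t| < r') : f r t = f r' t := by
    have hm : 0 < min r r' := (abs_nonneg t).trans_lt (lt_min ht ht')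
    refine ODE_solution_unique_of_mem_Ioo (v := fun _ ↦ F) (s := fun _ ↦ univ) (t₀ := 0)
      (fun _ _ ↦ hF.lipschitzOnWith) ⟨neg_lt_zero.2 hm, hm⟩
      (fun x hx ↦ ⟨hd r x ?_, mem_univ _⟩) (fun x hx ↦ ⟨hd r' x ?_, mem_univ _⟩)
      ((hf₀ r).trans (hf₀ r').symm) (abs_lt.1 (lt_min ht ht'))
    exacts [(abs_lt.2 hx).trans_le (min_le_left r r'), (abs_lt.2 hx).trans_le (min_le_right r r')]
  refine ⟨fun t ↦ f (|t| + 1) t, hf₀ _, fun t ↦ ?_⟩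
  refine (hd _ t (lt_add_one |t|)).congr_of_eventuallyEq ?_
  filter_upwards [continuous_abs.continuousAt.eventually_lt continuousAt_const (lt_add_one |t|)]
    with s hs using agree _ _ s (lt_add_one |s|) hs

end GlobalFlow

section Fall

theorem eq_zero_of_tendsto_of_tendsto_deriv {f f' : ℝ → ℝ} {c L : ℝ}
    (hf : ∀ t, HasDerivAt f (f' t) t) (hc : Tendsto f atTop (𝓝 c))
    (hL : Tendsto f' atTop (𝓝 L)) : L = 0 := by
  have mean_value (t : ℝ) : ∃ ξ ∈ Ioo t (t + 1), f' ξ = f (t + 1) - f t := by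
    simpa using exists_hasDerivAt_eq_slope f f' (lt_add_one t)
      (fun s _ ↦ (hf s).continuousAt.continuousWithinAt) fun s _ ↦ hf s
  choose ξ hξ hξ' using mean_value
  have hξ_top : Tendsto ξ atTop atTop := tendsto_atTop_mono (fun t ↦ (hξ t).1.le) tendsto_id
  have to_zero : Tendsto (fun t ↦ f (t + 1) - f t) atTop (𝓝 (c - c)) :=
    (hc.comp (tendsto_atTop_add_const_right _ 1 tendsto_id)).sub hc
  have to_L : Tendsto (fun t ↦ f (t + 1) - f t) atTop (𝓝 L) := by
    simpa only [Function.comp_def, hξ'] using hL.comp hξ_top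
  simpa using tendsto_nhds_unique to_L to_zero

theorem exists_tendsto_of_antitoneOn_Ici {f : ℝ → ℝ} {x₀ a : ℝ} (hf : AntitoneOn f (Ici x₀))
    (ha : ∀ x ∈ Ici x₀, a ≤ f x) : ∃ c, Tendsto f atTop (𝓝 c) := by
  have anti : Antitone fun x ↦ f (max x₀ x) := fun x y hxy ↦
    hf (mem_Ici.2 (le_max_left _ _)) (mem_Ici.2 (le_max_left _ _)) (max_le_max_left _ hxy)
  have bdd : BddBelow (range fun x ↦ f (max x₀ x)) :=
    ⟨a, forall_mem_range.2 fun x ↦ ha _ (mem_Ici.2 (le_max_left _ _))⟩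
  refine ⟨_, (tendsto_atTop_ciInf anti bdd).congr' ?_⟩
  filter_upwards [eventually_ge_atTop x₀] with x hx using by rw [max_eq_right hx]

theorem eventually_neg_nhdsGT {f : ℝ → ℝ} {f' x : ℝ} (hf : HasDerivAt f f' x)
    (h : f x < 0 ∨ f x = 0 ∧ f' < 0) : ∀ᶠ y in 𝓝[>] x, f y < 0 := by
  rcases h with h | ⟨h, h'⟩
  · exact (hf.continuousAt.eventually_lt_const h).filter_mono nhdsWithin_le_nhds
  · have hsign := eventually_nhdsWithin_sign_eq_of_deriv_neg (hf.deriv.symm ▸ h') h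
    filter_upwards [hsign.filter_mono nhdsWithin_le_nhds, self_mem_nhdsWithin] with y hy hxy
    rwa [sign_neg (sub_neg.2 hxy), sign_eq_neg_one_iff] at hy

theorem exists_first_zero {f : ℝ → ℝ} (hf : Continuous f) {x y : ℝ} (hxy : x < y) (hy : 0 ≤ f y)
    (hneg : ∀ᶠ z in 𝓝[>] x, f z < 0) : ∃ z > x, f z = 0 ∧ ∀ t ∈ Ioo x z, f t < 0 := by
  obtain ⟨ε, hε, hstart⟩ := mem_nhdsGT_iff_exists_Ioo_subset.1 hneg
  set S : Set ℝ := Ici ε ∩ {t | 0 ≤ f t}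
  have hyS : y ∈ S := ⟨not_lt.1 fun h ↦ (hstart ⟨hxy, h⟩).not_ge hy, hy⟩
  have hbdd : BddBelow S := ⟨ε, fun t ht ↦ ht.1⟩
  obtain ⟨hεz, hz⟩ : sInf S ∈ S :=
    (isClosed_Ici.inter (isClosed_le continuous_const hf)).csInf_mem ⟨y, hyS⟩ hbdd
  have hxz : x < sInf S := (mem_Ioi.1 hε).trans_le hεz
  have before (t : ℝ) (ht : t ∈ Ioo x (sInf S)) : f t < 0 := by
    by_contra! hft
    rcases lt_or_ge t ε with h | h
    · exact (hstart ⟨ht.1, h⟩).not_ge hft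
    · exact ht.2.not_ge (csInf_le hbdd ⟨h, hft⟩)
  refine ⟨sInf S, hxz, le_antisymm ?_ hz, before⟩
  refine le_of_tendsto (hf.continuousAt.mono_left (nhdsWithin_le_nhds (s := Iio (sInf S)))) ?_
  filter_upwards [Ioo_mem_nhdsLT hxz] with t ht using (before t ht).le

variable {u w P F : ℝ → ℝ} {a τ : ℝ}

theorem strictAntiOn_Icc_of_hasDerivAt_neg (hu : ∀ t, HasDerivAt u (w t) t)
    (hneg : ∀ t ∈ Ioo 0 τ, w t < 0) : StrictAntiOn u (Icc 0 τ) := by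
  refine strictAntiOn_of_hasDerivWithinAt_neg (f' := w) (convex_Icc 0 τ)
    (fun t _ ↦ (hu t).continuousAt.continuousWithinAt) (fun t _ ↦ (hu t).hasDerivWithinAt) ?_
  rwa [interior_Icc]

theorem le_of_fall_of_sq_eq (hu : ∀ t, HasDerivAt u (w t) t) (hP : ∀ t, w t ^ 2 = P (u t))
    (hPa : P a = 0) (ha : a < u 0) (hτ : 0 ≤ τ) (hneg : ∀ t ∈ Ioo 0 τ, w t < 0) : a ≤ u τ := by
  by_contra! hlt
  obtain ⟨t, ht, hta⟩ := intermediate_value_Ioo' hτ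
    (fun t _ ↦ (hu t).continuousAt.continuousWithinAt) (mem_Ioo.2 ⟨hlt, ha⟩)
  exact (hneg t ht).ne (pow_eq_zero_iff two_ne_zero |>.1 (by rw [hP, hta, hPa]))

-- A perpetual fall would converge to a zero of `P`, hence to `a`, where the force pushes back.
theorem exists_nonneg_of_fall (hu : ∀ t, HasDerivAt u (w t) t)
    (hw : ∀ t, HasDerivAt w (F (u t)) t) (hP : ∀ t, w t ^ 2 = P (u t)) (cP : Continuous P)
    (cF : Continuous F) (ha : a < u 0) (hPa : P a = 0) (hFa : 0 < F a)
    (hne : ∀ x ∈ Ioo a (u 0), P x ≠ 0) : ∃ t, 0 < t ∧ 0 ≤ w t := by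
  by_contra! hneg
  have anti : StrictAntiOn u (Ici 0) := fun s hs t _ hst ↦
    strictAntiOn_Icc_of_hasDerivAt_neg hu (fun x (hx : x ∈ Ioo 0 t) ↦ hneg x hx.1)
      ⟨hs, hst.le⟩ ⟨hs.trans hst.le, le_rfl⟩ hst
  have lower (t : ℝ) (ht : t ∈ Ici 0) : a ≤ u t :=
    le_of_fall_of_sq_eq hu hP hPa ha ht fun x hx ↦ hneg x hx.1
  obtain ⟨c, hc⟩ := exists_tendsto_of_antitoneOn_Ici anti.antitoneOn lower
  have hac : a ≤ c := ge_of_tendsto hc ((eventually_ge_atTop 0).mono lower)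
  have hcu : c < u 0 := by
    refine lt_of_le_of_lt (le_of_tendsto hc ?_) (anti self_mem_Ici (mem_Ici.2 zero_le_one) one_pos)
    filter_upwards [eventually_ge_atTop 1] with t ht
    exact anti.antitoneOn (mem_Ici.2 zero_le_one) (mem_Ici.2 (zero_le_one.trans ht)) ht
  have w_tendsto : Tendsto w atTop (𝓝 (-√(P c))) := by
    refine (((cP.tendsto c).comp hc).sqrt.neg).congr' ?_
    filter_upwards [eventually_gt_atTop 0] with t ht
    rw [Function.comp_apply, ← hP, Real.sqrt_sq_eq_abs, abs_of_neg (hneg t ht), neg_neg]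
  have hPc : P c = 0 := by
    have hPc₀ : 0 ≤ P c := ge_of_tendsto' ((cP.tendsto c).comp hc) fun t ↦ by
      rw [Function.comp_apply, ← hP]
      positivity
    exact (Real.sqrt_eq_zero hPc₀).1
      (neg_eq_zero.1 (eq_zero_of_tendsto_of_tendsto_deriv hu hc w_tendsto))
  obtain rfl : a = c := hac.eq_or_lt.resolve_right fun hlt ↦ hne c ⟨hlt, hcu⟩ hPc
  exact hFa.ne' (eq_zero_of_tendsto_of_tendsto_deriv hw w_tendsto ((cF.tendsto a).comp hc))

theorem exists_fall_time (hu : ∀ t, HasDerivAt u (w t) t)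
    (hw : ∀ t, HasDerivAt w (F (u t)) t) (hP : ∀ t, w t ^ 2 = P (u t)) (cP : Continuous P)
    (cF : Continuous F) (ha : a < u 0) (hPa : P a = 0) (hFa : 0 < F a)
    (hne : ∀ x ∈ Ioo a (u 0), P x ≠ 0) (hin : w 0 < 0 ∨ w 0 = 0 ∧ F (u 0) < 0) :
    ∃ τ, 0 < τ ∧ u τ = a ∧ w τ = 0 ∧ ∀ t ∈ Ioo 0 τ, w t < 0 := by
  have cw : Continuous w := continuous_iff_continuousAt.2 fun t ↦ (hw t).continuousAt
  obtain ⟨t, ht, hwt⟩ := exists_nonneg_of_fall hu hw hP cP cF ha hPa hFa hne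
  obtain ⟨τ, hτ, hwτ, hneg⟩ := exists_first_zero cw ht hwt (eventually_neg_nhdsGT (hw 0) hin)
  have hτ₀ : u τ < u 0 := strictAntiOn_Icc_of_hasDerivAt_neg hu hneg
    (left_mem_Icc.2 hτ.le) (right_mem_Icc.2 hτ.le) hτ
  have hPτ : P (u τ) = 0 := by rw [← hP, hwτ, zero_pow two_ne_zero]
  have haτ := (le_of_fall_of_sq_eq hu hP hPa ha hτ.le hneg).eq_or_lt
  exact ⟨τ, hτ, (haτ.resolve_right fun hlt ↦ hne _ ⟨hlt, hτ₀⟩ hPτ).symm, hwτ, hneg⟩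

end Fall

section Uniqueness

theorem lipschitzOnWith_mul_of_norm_le {α A : Type*} [PseudoMetricSpace α]
    [NonUnitalSeminormedRing A] {f g : α → A} {s : Set α} {Kf Kg Mf Mg : ℝ≥0}
    (hf : LipschitzOnWith Kf f s) (hg : LipschitzOnWith Kg g s) (hMf : ∀ x ∈ s, ‖f x‖ ≤ Mf)
    (hMg : ∀ x ∈ s, ‖g x‖ ≤ Mg) : LipschitzOnWith (Mf * Kg + Kf * Mg) (fun x ↦ f x * g x) s := by
  refine LipschitzOnWith.of_dist_le_mul fun x hx y hy ↦ ?_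
  calc dist (f x * g x) (f y * g y)
      = ‖f x * (g x - g y) + (f x - f y) * g y‖ := by rw [dist_eq_norm]; noncomm_ring
    _ ≤ ‖f x‖ * dist (g x) (g y) + dist (f x) (f y) * ‖g y‖ := by
      rw [dist_eq_norm, dist_eq_norm]
      exact (norm_add_le _ _).trans (add_le_add (norm_mul_le _ _) (norm_mul_le _ _))
    _ ≤ Mf * (Kg * dist x y) + Kf * dist x y * Mg := by
      gcongr
      exacts [hMf x hx, hg.dist_le_mul x hx y hy, hf.dist_le_mul x hx y hy, hMg y hy]
    _ = (Mf * Kg + Kf * Mg : ℝ≥0) * dist x y := by push_cast; ring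

/-- Newton's equation as a vector field on the phase space of positions and velocities. -/
noncomputable def newtonField (b : ℂ → ℝ) (x : ℂ × ℂ) : ℂ × ℂ :=
  (x.2, -Complex.I * (b x.1 : ℂ) * x.2)

theorem exists_lipschitzOnWith_newtonField {b : ℂ → ℝ} {S W : Set ℂ} (hS : IsCompact S)
    (hW : IsCompact W) (hb : LocallyLipschitzOn S b) :
    ∃ K, LipschitzOnWith K (newtonField b) (S ×ˢ W) := by
  obtain ⟨L, hL⟩ := hb.exists_lipschitzOnWith_of_compact hS
  obtain ⟨M, hM⟩ := hS.exists_bound_of_continuousOn hL.continuousOn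
  obtain ⟨R, hR⟩ := hW.exists_bound_of_continuousOn (f := id) continuousOn_id
  have lip_snd : LipschitzOnWith 1 Prod.snd (S ×ˢ W) := LipschitzWith.prod_snd.lipschitzOnWith
  have lip_force : LipschitzOnWith L (fun x : ℂ × ℂ ↦ -Complex.I * (b x.1 : ℂ)) (S ×ˢ W) := by
    refine LipschitzOnWith.of_dist_le_mul fun x hx y hy ↦ ?_
    rw [dist_eq_norm, ← mul_sub, ← Complex.ofReal_sub, norm_mul, norm_neg, Complex.norm_I, one_mul,
      Complex.norm_real, ← dist_eq_norm]
    exact (hL.dist_le_mul _ hx.1 _ hy.1).trans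
      (mul_le_mul_of_nonneg_left (le_max_left _ _) L.coe_nonneg)
  refine ⟨_, lip_snd.prodMk (lipschitzOnWith_mul_of_norm_le (Mf := M.toNNReal) (Mg := R.toNNReal)
    lip_force lip_snd (fun x hx ↦ ?_) fun x hx ↦ (hR x.2 hx.2).trans (Real.le_coe_toNNReal R))⟩
  rw [norm_mul, norm_neg, Complex.norm_I, one_mul, Complex.norm_real]
  exact (hM x.1 hx.1).trans (Real.le_coe_toNNReal M)

namespace IsTrajectoryOn

variable {b : ℂ → ℝ} {U : Set ℂ} {T T' : ℝ} {q v q' v' : ℝ → ℂ}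

theorem mono (h : IsTrajectoryOn b U T q v) (hT : T' ≤ T) : IsTrajectoryOn b U T' q v where
  mem t ht := h.mem t (Icc_subset_Icc_right hT ht)
  velocity t ht := (h.velocity t (Icc_subset_Icc_right hT ht)).mono (Icc_subset_Icc_right hT)
  newton t ht := (h.newton t (Icc_subset_Icc_right hT ht)).mono (Icc_subset_Icc_right hT)

theorem isIntegralCurveOn (h : IsTrajectoryOn b U T q v) :
    IsIntegralCurveOn (fun t ↦ (q t, v t)) (fun _ ↦ newtonField b) (Icc 0 T) :=
  fun t ht ↦ (h.velocity t ht).prodMk (h.newton t ht)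

theorem eqOn (hb : LocallyLipschitzOn U b) (h : IsTrajectoryOn b U T q v)
    (h' : IsTrajectoryOn b U T q' v') (hq : q 0 = q' 0) (hv : v 0 = v' 0) :
    EqOn (fun t ↦ (q t, v t)) (fun t ↦ (q' t, v' t)) (Icc 0 T) := by
  have cq : ContinuousOn q (Icc 0 T) := fun t ht ↦ (h.velocity t ht).continuousWithinAt
  have cv : ContinuousOn v (Icc 0 T) := fun t ht ↦ (h.newton t ht).continuousWithinAt
  have cq' : ContinuousOn q' (Icc 0 T) := fun t ht ↦ (h'.velocity t ht).continuousWithinAt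
  have cv' : ContinuousOn v' (Icc 0 T) := fun t ht ↦ (h'.newton t ht).continuousWithinAt
  obtain ⟨K, hK⟩ := exists_lipschitzOnWith_newtonField
    ((isCompact_Icc.image_of_continuousOn cq).union (isCompact_Icc.image_of_continuousOn cq'))
    ((isCompact_Icc.image_of_continuousOn cv).union (isCompact_Icc.image_of_continuousOn cv'))
    (hb.mono (union_subset (image_subset_iff.2 h.mem) (image_subset_iff.2 h'.mem)))
  have right_deriv {γ : ℝ → ℂ × ℂ} (hγ : IsIntegralCurveOn γ (fun _ ↦ newtonField b) (Icc 0 T)) :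
      ∀ t ∈ Ico 0 T, HasDerivWithinAt γ (newtonField b (γ t)) (Ici t) t := fun t ht ↦
    (hγ t (Ico_subset_Icc_self ht)).mono_of_mem_nhdsWithin
      (mem_of_superset (Icc_mem_nhdsGE ht.2) (Icc_subset_Icc_left ht.1))
  refine ODE_solution_unique_of_mem_Icc_right (fun _ _ ↦ hK)
    h.isIntegralCurveOn.continuousOn (right_deriv h.isIntegralCurveOn) (fun t ht ↦ ?_)
    h'.isIntegralCurveOn.continuousOn (right_deriv h'.isIntegralCurveOn) (fun t ht ↦ ?_)
    (Prod.ext hq hv)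
  exacts [⟨.inl (mem_image_of_mem q (Ico_subset_Icc_self ht)),
      .inl (mem_image_of_mem v (Ico_subset_Icc_self ht))⟩,
    ⟨.inr (mem_image_of_mem q' (Ico_subset_Icc_self ht)),
      .inr (mem_image_of_mem v' (Ico_subset_Icc_self ht))⟩]

end IsTrajectoryOn

end Uniqueness

section DirectionField

/-- Newton's equation at constant speed, as a vector field in the position and the angle by which
the velocity has turned away from `v₀`. Unlike `newtonField` it is bounded and globally Lipschitz
as soon as `β` is. -/
noncomputable def directionField (β : ℂ → ℝ) (v₀ : ℂ) (x : ℂ × ℝ) : ℂ × ℝ :=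
  (v₀ * Complex.exp (x.2 * Complex.I), -β x.1)

theorem hasDerivAt_exp_ofReal_mul_I (x : ℝ) :
    HasDerivAt (fun x : ℝ ↦ Complex.exp (x * Complex.I))
      (Complex.exp (x * Complex.I) * Complex.I) x := by
  simpa using ((hasDerivAt_id x).ofReal_comp.mul_const Complex.I).cexp

theorem lipschitzWith_directionField {β : ℂ → ℝ} {K : ℝ≥0} (hβ : LipschitzWith K β) (v₀ : ℂ) :
    LipschitzWith (max ‖v₀‖₊ K) (directionField β v₀) := by
  have hexp : LipschitzWith ‖v₀‖₊ fun x : ℝ ↦ v₀ * Complex.exp (x * Complex.I) := by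
    have hd (x : ℝ) := (hasDerivAt_exp_ofReal_mul_I x).const_mul v₀
    refine lipschitzWith_of_nnnorm_deriv_le (fun x ↦ (hd x).differentiableAt) fun x ↦ ?_
    rw [(hd x).deriv, ← NNReal.coe_le_coe]
    simp
  have := (hexp.comp LipschitzWith.prod_snd).prodMk (hβ.neg.comp LipschitzWith.prod_fst)
  rwa [mul_one, mul_one] at this

theorem norm_directionField_le {β : ℂ → ℝ} {M : ℝ≥0} (hM : ∀ z, ‖β z‖ ≤ M) (v₀ : ℂ) (x : ℂ × ℝ) :
    ‖directionField β v₀ x‖ ≤ (max ‖v₀‖₊ M : ℝ≥0) := by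
  refine max_le_max (le_of_eq ?_) ((norm_neg _).trans_le (hM _))
  rw [directionField, norm_mul, Complex.norm_exp_ofReal_mul_I, mul_one]
  rfl

end DirectionField

/-- A motion for all times in the magnetic field `β` on the whole plane, with position `q` and
velocity `v`. -/
structure IsMotion (β : ℂ → ℝ) (q v : ℝ → ℂ) : Prop where
  velocity : ∀ t, HasDerivAt q (v t) t
  newton : ∀ t, HasDerivAt v (-Complex.I * (β (q t) : ℂ) * v t) t

/-- The curve `q` with velocity `v` is symmetric about time `τ`: running backwards from `τ` is the
mirror image of running forwards, under the reflection `z ↦ -E z̄` in a line through the origin. -/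
structure IsReflectionSymmetricAt (q v : ℝ → ℂ) (E : ℂ) (τ : ℝ) : Prop where
  norm_eq_one : ‖E‖ = 1
  reflect : ∀ t, 0 ≤ t → q (τ + t) = -(E * conj (q (τ - t))) ∧ v (τ + t) = E * conj (v (τ - t))

theorem exists_reflection_of_re_conj_mul_eq_zero {z y : ℂ} (hy : y ≠ 0)
    (h : (conj z * y).re = 0) : ∃ E : ℂ, ‖E‖ = 1 ∧ z = -(E * conj z) ∧ y = E * conj y := by
  have hy' : conj y ≠ 0 := (map_ne_zero _).2 hy
  have hanti : z * conj y = -(y * conj z) := by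
    have : conj (conj z * y) = -(conj z * y) :=
      Complex.ext (by rw [Complex.conj_re, Complex.neg_re, h, neg_zero]) (Complex.conj_im _)
    rwa [map_mul, Complex.conj_conj, mul_comm (conj z)] at this
  refine ⟨y / conj y, ?_, ?_, (div_mul_cancel₀ y hy').symm⟩
  · rw [norm_div, RCLike.norm_conj, div_self (norm_ne_zero_iff.2 hy)]
  · rw [div_mul_eq_mul_div, ← neg_div, ← hanti, mul_div_cancel_right₀ z hy']

namespace IsMotion

theorem exists_of_lipschitzWith {β : ℂ → ℝ} {K M : ℝ≥0} (hβ : LipschitzWith K β)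
    (hM : ∀ z, ‖β z‖ ≤ M) (q₀ v₀ : ℂ) : ∃ q v, IsMotion β q v ∧ q 0 = q₀ ∧ v 0 = v₀ := by
  obtain ⟨f, hf₀, hf⟩ := exists_isIntegralCurve_of_lipschitzWith
    (lipschitzWith_directionField hβ v₀) (norm_directionField_le hM v₀) (q₀, 0)
  have hq (t : ℝ) : HasDerivAt (fun t ↦ (f t).1) (directionField β v₀ (f t)).1 t :=
    (hf.isIntegralCurveAt t).hasDerivAt.fst
  have hψ (t : ℝ) : HasDerivAt (fun t ↦ (f t).2) (directionField β v₀ (f t)).2 t :=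
    (hf.isIntegralCurveAt t).hasDerivAt.snd
  refine ⟨fun t ↦ (f t).1, fun t ↦ (directionField β v₀ (f t)).1, ⟨hq, fun t ↦ ?_⟩, ?_, ?_⟩
  · refine (((hasDerivAt_exp_ofReal_mul_I _).scomp t (hψ t)).const_mul v₀).congr_deriv ?_
    simp only [directionField, Complex.real_smul, Complex.ofReal_neg]
    ring
  · simp only [hf₀]
  · simp [directionField, hf₀]

variable {β b : ℂ → ℝ} {U : Set ℂ} {q v : ℝ → ℂ} {T : ℝ}

theorem continuous_position (h : IsMotion β q v) : Continuous q :=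
  continuous_iff_continuousAt.2 fun t ↦ (h.velocity t).continuousAt

theorem continuous_velocity (h : IsMotion β q v) : Continuous v :=
  continuous_iff_continuousAt.2 fun t ↦ (h.newton t).continuousAt

theorem isTrajectoryOn (h : IsMotion β q v) (hU : ∀ t ∈ Icc 0 T, q t ∈ U)
    (hb : ∀ t ∈ Icc 0 T, β (q t) = b (q t)) : IsTrajectoryOn b U T q v where
  mem := hU
  velocity t _ := (h.velocity t).hasDerivWithinAt
  newton t ht := hb t ht ▸ (h.newton t).hasDerivWithinAt

theorem norm_velocity (h : IsMotion β q v) (t : ℝ) : ‖v t‖ = ‖v 0‖ := by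
  have hd (t : ℝ) : HasDerivAt (fun t ↦ ‖v t‖ ^ 2) 0 t := by
    refine (h.newton t).norm_sq.congr_deriv ?_
    rw [Complex.inner, mul_assoc, mul_assoc, Complex.mul_conj]
    simp
  have := is_const_of_deriv_eq_zero (fun t ↦ (hd t).differentiableAt) (fun t ↦ (hd t).deriv) t 0
  exact (sq_eq_sq₀ (norm_nonneg _) (norm_nonneg _)).1 this

theorem comp_const_add (h : IsMotion β q v) (τ : ℝ) :
    IsMotion β (fun t ↦ q (τ + t)) (fun t ↦ v (τ + t)) where
  velocity t := (h.velocity (τ + t)).comp_const_add τ t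
  newton t := (h.newton (τ + t)).comp_const_add τ t

theorem reflect (h : IsMotion β q v) (hβ : ∀ z z', ‖z‖ = ‖z'‖ → β z = β z') {E : ℂ}
    (hE : ‖E‖ = 1) (τ : ℝ) :
    IsMotion β (fun t ↦ -(E * conj (q (τ - t)))) (fun t ↦ E * conj (v (τ - t))) where
  velocity t := by
    refine (((h.velocity (τ - t)).comp_const_sub τ t).star.const_mul E).neg.congr_deriv ?_
    simp
  newton t := by
    have hrefl : β (-(E * conj (q (τ - t)))) = β (q (τ - t)) :=
      hβ _ _ (by rw [norm_neg, norm_mul, hE, one_mul, RCLike.norm_conj])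
    refine (((h.newton (τ - t)).comp_const_sub τ t).star.const_mul E).congr_deriv ?_
    simp only [Complex.star_def, map_neg, map_mul, Complex.conj_I, Complex.conj_ofReal, hrefl]
    ring

theorem exists_isReflectionSymmetricAt (h : IsMotion β q v) (hlip : LocallyLipschitz β)
    (hβ : ∀ z z', ‖z‖ = ‖z'‖ → β z = β z') {τ : ℝ} (hv : v τ ≠ 0)
    (hw : (conj (q τ) * v τ).re = 0) :
    ∃ E, IsReflectionSymmetricAt q v E τ ∧ v τ ^ 2 = ‖v τ‖ ^ 2 * E := by
  obtain ⟨E, hE, hqE, hvE⟩ := exists_reflection_of_re_conj_mul_eq_zero hv hw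
  refine ⟨E, ⟨hE, fun t ht ↦ ?_⟩, by nth_rw 1 [sq, hvE, ← Complex.conj_mul']; ring⟩
  have h₁ : IsTrajectoryOn β univ t _ _ :=
    (h.comp_const_add τ).isTrajectoryOn (fun _ _ ↦ mem_univ _) fun _ _ ↦ rfl
  have h₂ : IsTrajectoryOn β univ t _ _ :=
    (h.reflect hβ hE τ).isTrajectoryOn (fun _ _ ↦ mem_univ _) fun _ _ ↦ rfl
  exact Prod.ext_iff.1 (h₁.eqOn hlip.locallyLipschitzOn h₂ (by simpa using hqE)
    (by simpa using hvE) (right_mem_Icc.2 ht))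

theorem hasDerivAt_conj_mul (h : IsMotion β q v) (t : ℝ) :
    HasDerivAt (fun t ↦ conj (q t) * v t)
      (((‖v t‖ ^ 2 : ℝ) : ℂ) - Complex.I * (β (q t) * (conj (q t) * v t))) t := by
  refine ((h.velocity t).star.mul (h.newton t)).congr_deriv ?_
  rw [Complex.ofReal_pow, ← Complex.conj_mul']
  simp only [Complex.star_def]
  ring

theorem hasDerivAt_re_conj_mul (h : IsMotion β q v) (t : ℝ) :
    HasDerivAt (fun t ↦ (conj (q t) * v t).re)
      (‖v t‖ ^ 2 + β (q t) * (conj (q t) * v t).im) t := by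
  refine (Complex.reCLM.hasFDerivAt.comp_hasDerivAt t (h.hasDerivAt_conj_mul t)).congr_deriv ?_
  rw [Complex.reCLM_apply, Complex.sub_re, Complex.ofReal_re, Complex.I_mul_re,
    Complex.im_ofReal_mul, sub_neg_eq_add]

theorem hasDerivAt_im_conj_mul (h : IsMotion β q v) (t : ℝ) :
    HasDerivAt (fun t ↦ (conj (q t) * v t).im) (-(β (q t) * (conj (q t) * v t).re)) t := by
  refine (Complex.imCLM.hasFDerivAt.comp_hasDerivAt t (h.hasDerivAt_conj_mul t)).congr_deriv ?_
  rw [Complex.imCLM_apply, Complex.sub_im, Complex.ofReal_im, Complex.I_mul_im,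
    Complex.re_ofReal_mul, zero_sub]

end IsMotion

section Pericenter

theorem hasDerivAt_norm_of_ne_zero {V : Type*} [NormedAddCommGroup V] [InnerProductSpace ℝ V]
    {q : ℝ → V} {q' : V} {t : ℝ} (hq : HasDerivAt q q' t) (h₀ : q t ≠ 0) :
    HasDerivAt (fun t ↦ ‖q t‖) (inner ℝ (q t) q' / ‖q t‖) t := by
  have h := hq.norm_sq.sqrt (pow_ne_zero 2 (norm_ne_zero_iff.2 h₀))
  simp only [Real.sqrt_sq (norm_nonneg _)] at h
  exact h.congr_deriv (mul_div_mul_left _ _ two_ne_zero)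

theorem re_sq_add_im_sq_conj_mul (z y : ℂ) :
    (conj z * y).re ^ 2 + (conj z * y).im ^ 2 = ‖y‖ ^ 2 * ‖z‖ ^ 2 := by
  rw [sq, sq, ← Complex.normSq_apply, Complex.normSq_eq_norm_sq, norm_mul, RCLike.norm_conj,
    mul_pow, mul_comm]

theorem norm_lt_norm_add_smul {V : Type*} [NormedAddCommGroup V] [InnerProductSpace ℝ V] {z y : V}
    (hy : y ≠ 0) (h : 0 ≤ inner ℝ z y) {s : ℝ} (hs : 0 < s) : ‖z‖ < ‖z + s • y‖ := by
  refine lt_of_pow_lt_pow_left₀ 2 (norm_nonneg _) ?_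
  have : 0 < ‖s • y‖ := norm_pos_iff.2 (smul_ne_zero hs.ne' hy)
  rw [norm_add_sq_real, real_inner_smul_right]
  nlinarith [mul_nonneg hs.le h]

/-- The curve `q` with velocity `v` approaches the origin during `(0, τ)`, and at time `τ` its
velocity is perpendicular to its position. Passing through the origin at time `τ` counts as
reaching a pericenter. -/
structure ReachesPericenterAt (q v : ℝ → ℂ) (τ : ℝ) : Prop where
  pos : 0 < τ
  approaching : ∀ t ∈ Ioo 0 τ, (conj (q t) * v t).re < 0
  perpendicular : (conj (q τ) * v τ).re = 0

namespace ReachesPericenterAt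

variable {q v : ℝ → ℂ} {τ : ℝ}

theorem strictAntiOn_norm (hτ : ReachesPericenterAt q v τ) (hq : ∀ t, HasDerivAt q (v t) t) :
    StrictAntiOn (fun t ↦ ‖q t‖) (Icc 0 τ) := fun x hx y hy hxy ↦
  lt_of_pow_lt_pow_left₀ 2 (norm_nonneg _) <|
    strictAntiOn_Icc_of_hasDerivAt_neg (fun t ↦ (hq t).norm_sq)
      (fun t ht ↦ by
        rw [Complex.inner, mul_comm (v t)]
        exact mul_neg_of_pos_of_neg two_pos (hτ.approaching t ht)) hx hy hxy

theorem ne_zero (hτ : ReachesPericenterAt q v τ) (hq : ∀ t, HasDerivAt q (v t) t) {t : ℝ}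
    (ht : t ∈ Ico 0 τ) : q t ≠ 0 :=
  norm_pos_iff.1 <| (norm_nonneg (q τ)).trans_lt <|
    hτ.strictAntiOn_norm hq (Ico_subset_Icc_self ht) (right_mem_Icc.2 hτ.pos.le) ht.2

theorem re_conj_mul_nonpos (hτ : ReachesPericenterAt q v τ) (cq : Continuous q)
    (cv : Continuous v) : (conj (q 0) * v 0).re ≤ 0 := by
  have c : Continuous fun t ↦ (conj (q t) * v t).re := by fun_prop
  refine le_of_tendsto ((c.tendsto 0).mono_left (nhdsWithin_le_nhds (s := Ioi 0))) ?_
  filter_upwards [Ioo_mem_nhdsGT hτ.pos] with t ht using (hτ.approaching t ht).le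

end ReachesPericenterAt

namespace IsReflectionSymmetricAt

variable {q v : ℝ → ℂ} {τ : ℝ} {E : ℂ}

theorem two_mul (h : IsReflectionSymmetricAt q v E τ) (hτ : 0 ≤ τ) :
    q (2 * τ) = -(E * conj (q 0)) ∧ v (2 * τ) = E * conj (v 0) := by
  simpa only [_root_.two_mul, sub_self] using h.reflect τ hτ

theorem norm_two_mul_sub (h : IsReflectionSymmetricAt q v E τ) {t : ℝ} (ht : t ≤ τ) :
    ‖q (2 * τ - t)‖ = ‖q t‖ := by
  have := (h.reflect (τ - t) (sub_nonneg.2 ht)).1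
  rw [sub_sub_cancel, ← add_sub_assoc, ← _root_.two_mul] at this
  rw [this, norm_neg, norm_mul, h.norm_eq_one, one_mul, RCLike.norm_conj]

theorem exists_norm_eq (h : IsReflectionSymmetricAt q v E τ) {t : ℝ} (ht : t ∈ Icc 0 (2 * τ)) :
    ∃ t' ∈ Icc 0 τ, ‖q t'‖ = ‖q t‖ ∧ (t ∈ Ioo 0 (2 * τ) → 0 < t') := by
  rcases le_total t τ with htτ | htτ
  · exact ⟨t, ⟨ht.1, htτ⟩, rfl, And.left⟩
  · refine ⟨2 * τ - t, ⟨by linarith [ht.2], by linarith⟩, ?_, fun ht' ↦ by linarith [ht'.2]⟩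
    rw [← h.norm_two_mul_sub (by linarith), sub_sub_cancel]

theorem re_conj_mul_two_mul (h : IsReflectionSymmetricAt q v E τ) (hτ : 0 ≤ τ) :
    (conj (q (2 * τ)) * v (2 * τ)).re = -(conj (q 0) * v 0).re := by
  have hE : conj E * E = 1 := by simp [Complex.conj_mul', h.norm_eq_one]
  have : conj (q (2 * τ)) * v (2 * τ) = -conj (conj (q 0) * v 0) := by
    rw [(h.two_mul hτ).1, (h.two_mul hτ).2]
    simp only [map_neg, map_mul, Complex.conj_conj]
    linear_combination (-(q 0 * conj (v 0))) * hE
  rw [this, Complex.neg_re, Complex.conj_re]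

theorem norm_le_norm_zero (h : IsReflectionSymmetricAt q v E τ) (hτ : ReachesPericenterAt q v τ)
    (hq : ∀ t, HasDerivAt q (v t) t) {t : ℝ} (ht : t ∈ Icc 0 (2 * τ)) : ‖q t‖ ≤ ‖q 0‖ := by
  obtain ⟨t', ht', heq, -⟩ := h.exists_norm_eq ht
  exact heq ▸ (hτ.strictAntiOn_norm hq).antitoneOn (left_mem_Icc.2 hτ.pos.le) ht' ht'.1

theorem norm_pericenter_le (h : IsReflectionSymmetricAt q v E τ) (hτ : ReachesPericenterAt q v τ)
    (hq : ∀ t, HasDerivAt q (v t) t) {t : ℝ} (ht : t ∈ Icc 0 (2 * τ)) : ‖q τ‖ ≤ ‖q t‖ := by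
  obtain ⟨t', ht', heq, -⟩ := h.exists_norm_eq ht
  exact heq ▸ (hτ.strictAntiOn_norm hq).antitoneOn ht' (right_mem_Icc.2 hτ.pos.le) ht'.2

theorem escapesAt (h : IsReflectionSymmetricAt q v E τ) (hτ : ReachesPericenterAt q v τ)
    (hq : ∀ t, HasDerivAt q (v t) t) (cv : Continuous v) (hq₀ : ‖q 0‖ = 1) (hv₀ : v 0 ≠ 0) :
    EscapesAt q v (2 * τ) := by
  obtain ⟨hqT, hvT⟩ := h.two_mul hτ.pos.le
  have cq : Continuous q := continuous_iff_continuousAt.2 fun t ↦ (hq t).continuousAt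
  have hT : ‖q (2 * τ)‖ = 1 := by simp [hqT, h.norm_eq_one, hq₀]
  have hvT₀ : v (2 * τ) ≠ 0 := by
    rw [hvT]
    exact mul_ne_zero (norm_ne_zero_iff.1 (by simp [h.norm_eq_one])) ((map_ne_zero _).2 hv₀)
  refine ⟨mul_pos two_pos hτ.pos, fun t ht ↦ ?_, hT, fun s hs ↦ ?_⟩
  · obtain ⟨t', ht', heq, hpos⟩ := h.exists_norm_eq (Ioo_subset_Icc_self ht)
    rw [← heq, ← hq₀]
    exact hτ.strictAntiOn_norm hq (left_mem_Icc.2 hτ.pos.le) ht' (hpos ht)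
  · rw [← hT, ← Complex.real_smul]
    refine norm_lt_norm_add_smul hvT₀ ?_ hs
    rw [Complex.inner, mul_comm, h.re_conj_mul_two_mul hτ.pos.le]
    exact neg_nonneg.2 (hτ.re_conj_mul_nonpos cq cv)

end IsReflectionSymmetricAt

end Pericenter

section SweptAngle

theorem hasDerivAt_div_conj {q : ℝ → ℂ} {q' : ℂ} {t : ℝ} (hq : HasDerivAt q q' t)
    (h₀ : q t ≠ 0) : HasDerivAt (fun t ↦ q t / conj (q t))
      (q t / conj (q t) * (2 * ((conj (q t) * q').im / ‖q t‖ ^ 2 : ℝ) * Complex.I)) t := by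
  have hc : conj (q t) ≠ 0 := (map_ne_zero _).2 h₀
  have him : q' * conj (q t) - q t * conj q' = 2 * (conj (q t) * q').im * Complex.I := by
    have := Complex.sub_conj (conj (q t) * q')
    rw [map_mul, Complex.conj_conj, Complex.ofReal_mul, Complex.ofReal_ofNat] at this
    rw [← this, mul_comm q']
  refine (hq.div hq.star hc).congr_deriv ?_
  rw [Complex.star_def, him, Complex.ofReal_div, Complex.ofReal_pow, ← Complex.conj_mul']
  field_simp

theorem sq_eq_div_conj_mul_of_im_conj_mul_eq {z y : ℂ} {κ : ℝ} (hz : z ≠ 0)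
    (hκ : (conj z * y).im = κ * ‖z‖ ^ 2) :
    y ^ 2 = z / conj z * ((‖y‖ ^ 2 - 2 * ((conj z * y).im * κ) : ℝ) +
      (2 * ((conj z * y).re * κ) : ℝ) * Complex.I) := by
  have hc : conj z ≠ 0 := (map_ne_zero _).2 hz
  have hm : (conj z * y) ^ 2 = ((‖y‖ ^ 2 - 2 * ((conj z * y).im * κ) : ℝ) +
      (2 * ((conj z * y).re * κ) : ℝ) * Complex.I) * (conj z * z) := by
    have hn : (conj z * y).re ^ 2 + (conj z * y).im ^ 2 = ‖y‖ ^ 2 * ‖z‖ ^ 2 :=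
      re_sq_add_im_sq_conj_mul z y
    rw [Complex.conj_mul', ← Complex.ofReal_pow]
    generalize conj z * y = m at *
    apply Complex.ext <;>
      simp only [sq, Complex.mul_re, Complex.add_re, Complex.add_im, Complex.mul_im,
        Complex.ofReal_re, Complex.ofReal_im, Complex.I_re, Complex.I_im] at *
    · linear_combination hn - 2 * m.im * hκ
    · linear_combination 2 * m.re * hκ
  rw [div_mul_eq_mul_div, eq_div_iff hc]
  refine mul_left_cancel₀ hc ?_
  linear_combination hm

variable {q v : ℝ → ℂ} {κ : ℝ → ℝ} {τ : ℝ}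

theorem div_conj_eq_mul_exp_integral (hq : ∀ t, HasDerivAt q (v t) t) (cκ : Continuous κ)
    (hne : ∀ t ∈ Ico 0 τ, q t ≠ 0)
    (hκ : ∀ t ∈ Ico 0 τ, (conj (q t) * v t).im = κ t * ‖q t‖ ^ 2) {t : ℝ} (ht : t ∈ Ico 0 τ) :
    q t / conj (q t) =
      q 0 / conj (q 0) * Complex.exp (2 * (∫ x in (0 : ℝ)..t, κ x : ℝ) * Complex.I) := by
  have hΘ (t : ℝ) : HasDerivAt (fun t ↦ Complex.exp (-(2 * (∫ x in (0 : ℝ)..t, κ x : ℝ) *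
      Complex.I))) (Complex.exp (-(2 * (∫ x in (0 : ℝ)..t, κ x : ℝ) * Complex.I)) *
        -(2 * (κ t : ℂ) * Complex.I)) t :=
    ((((cκ.integral_hasStrictDerivAt 0 t).hasDerivAt.ofReal_comp).const_mul 2).mul_const
      Complex.I).neg.cexp
  have hd (x : ℝ) (hx : x ∈ Ico 0 τ) : HasDerivAt (fun t ↦ q t / conj (q t) *
      Complex.exp (-(2 * (∫ x in (0 : ℝ)..t, κ x : ℝ) * Complex.I))) 0 x := by
    refine ((hasDerivAt_div_conj (hq x) (hne x hx)).mul (hΘ x)).congr_deriv ?_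
    rw [hκ x hx, mul_div_cancel_right₀ _ (pow_ne_zero 2 (norm_ne_zero_iff.2 (hne x hx)))]
    ring
  have hsub (x : ℝ) (hx : x ∈ Icc 0 t) : x ∈ Ico 0 τ := ⟨hx.1, hx.2.trans_lt ht.2⟩
  have hconst := constant_of_has_deriv_right_zero
    (fun x hx ↦ (hd x (hsub x hx)).continuousAt.continuousWithinAt)
    (fun x hx ↦ (hd x (hsub x (Ico_subset_Icc_self hx))).hasDerivWithinAt) t ⟨ht.1, le_rfl⟩
  rw [intervalIntegral.integral_same, Complex.ofReal_zero, mul_zero, zero_mul, neg_zero,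
    Complex.exp_zero, mul_one] at hconst
  rw [← hconst, mul_assoc, ← Complex.exp_add, neg_add_cancel, Complex.exp_zero, mul_one]

-- Squaring the velocity removes the ambiguity of direction at the origin, where the position has
-- no polar angle, so that the formula survives when `q τ = 0`.
theorem velocity_sq_eq_mul_exp_integral (hq : ∀ t, HasDerivAt q (v t) t) (cv : Continuous v)
    (cκ : Continuous κ) (hτ : 0 < τ) (hne : ∀ t ∈ Ico 0 τ, q t ≠ 0)
    (hκ : ∀ t ∈ Ico 0 τ, (conj (q t) * v t).im = κ t * ‖q t‖ ^ 2) :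
    v τ ^ 2 = q 0 / conj (q 0) * Complex.exp (2 * (∫ t in (0 : ℝ)..τ, κ t : ℝ) * Complex.I) *
      ((‖v τ‖ ^ 2 - 2 * ((conj (q τ) * v τ).im * κ τ) : ℝ) +
        (2 * ((conj (q τ) * v τ).re * κ τ) : ℝ) * Complex.I) := by
  have cq : Continuous q := continuous_iff_continuousAt.2 fun t ↦ (hq t).continuousAt
  refine EqOn.of_subset_closure (f := fun t ↦ v t ^ 2) (g := fun t ↦ q 0 / conj (q 0) *
      Complex.exp (2 * (∫ x in (0 : ℝ)..t, κ x : ℝ) * Complex.I) *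
      ((‖v t‖ ^ 2 - 2 * ((conj (q t) * v t).im * κ t) : ℝ) +
        (2 * ((conj (q t) * v t).re * κ t) : ℝ) * Complex.I))
    (fun t ht ↦ ?_) (by fun_prop) (by fun_prop) Ico_subset_Icc_self
    (closure_Ico hτ.ne).ge (right_mem_Icc.2 hτ.le)
  beta_reduce
  rw [← div_conj_eq_mul_exp_integral hq cκ hne hκ ht]
  exact sq_eq_div_conj_mul_of_im_conj_mul_eq (hne t ht) (hκ t ht)

theorem conj_sq_mul_div_conj (z y : ℂ) (hz : z ≠ 0) :
    conj y ^ 2 * (z / conj z) =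
      ‖y‖ ^ 2 * Complex.exp ((-2 * orientedAngle z y : ℝ) * Complex.I) := by
  have hc : conj z ≠ 0 := (map_ne_zero _).2 hz
  have hn : (‖z‖ : ℂ) ≠ 0 := Complex.ofReal_ne_zero.2 (norm_ne_zero_iff.2 hz)
  have hpolar : z * conj y
      = ‖z‖ * ‖y‖ * Complex.exp (-(orientedAngle z y * Complex.I)) := by
    have := congrArg conj (Complex.norm_mul_exp_arg_mul_I (conj z * y))
    rw [norm_mul, RCLike.norm_conj] at this
    simp only [map_mul, Complex.conj_conj, Complex.conj_ofReal, ← Complex.exp_conj,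
      Complex.conj_I, Complex.ofReal_mul, mul_neg] at this
    exact this.symm
  have hsq : (z * conj y) ^ 2 = ‖z‖ ^ 2 *
      (‖y‖ ^ 2 * Complex.exp ((-2 * orientedAngle z y : ℝ) * Complex.I)) := by
    rw [hpolar, mul_pow, ← Complex.exp_nat_mul]
    push_cast
    ring_nf
  refine mul_left_cancel₀ (pow_ne_zero 2 hn) (Eq.trans ?_ hsq)
  rw [← Complex.conj_mul']
  field_simp

theorem IsReflectionSymmetricAt.conj_velocity_mul_velocity {E : ℂ}
    (h : IsReflectionSymmetricAt q v E τ) (hE : v τ ^ 2 = ‖v τ‖ ^ 2 * E)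
    (hτ : ReachesPericenterAt q v τ) (hq : ∀ t, HasDerivAt q (v t) t) (cv : Continuous v)
    (hv : ‖v τ‖ = ‖v 0‖) (hv₀ : v 0 ≠ 0) (cκ : Continuous κ)
    (hκ : ∀ t ∈ Ico 0 τ, (conj (q t) * v t).im = κ t * ‖q t‖ ^ 2) :
    conj (v 0) * v (2 * τ) = (‖v 0‖ ^ 2 - 2 * ((conj (q τ) * v τ).im * κ τ) : ℝ) *
      Complex.exp ((2 * (∫ t in (0 : ℝ)..τ, κ t) - 2 * orientedAngle (q 0) (v 0) : ℝ) *
        Complex.I) := by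
  have hne (t : ℝ) (ht : t ∈ Ico 0 τ) : q t ≠ 0 := hτ.ne_zero hq ht
  have hsq := velocity_sq_eq_mul_exp_integral hq cv cκ hτ.pos hne hκ
  rw [hE, hτ.perpendicular, hv, zero_mul, mul_zero, Complex.ofReal_zero, zero_mul, add_zero] at hsq
  have hn : (‖v 0‖ : ℂ) ^ 2 ≠ 0 :=
    pow_ne_zero 2 (Complex.ofReal_ne_zero.2 (norm_ne_zero_iff.2 hv₀))
  refine mul_left_cancel₀ hn ?_
  calc (‖v 0‖ : ℂ) ^ 2 * (conj (v 0) * v (2 * τ))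
      = conj (v 0) ^ 2 * (‖v 0‖ ^ 2 * E) := by rw [(h.two_mul hτ.pos.le).2]; ring
    _ = conj (v 0) ^ 2 * (q 0 / conj (q 0)) *
          Complex.exp (2 * (∫ t in (0 : ℝ)..τ, κ t : ℝ) * Complex.I) *
          (‖v 0‖ ^ 2 - 2 * ((conj (q τ) * v τ).im * κ τ) : ℝ) := by rw [hsq]; ring
    _ = _ := by
      rw [conj_sq_mul_div_conj _ _ (hne 0 ⟨le_rfl, hτ.pos⟩), mul_assoc, mul_assoc, mul_assoc,
        ← mul_assoc (Complex.exp _), ← Complex.exp_add, mul_comm (Complex.exp _)]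
      push_cast
      ring_nf

theorem ReachesPericenterAt.integral_radius_eq (hτ : ReachesPericenterAt q v τ)
    (hq : ∀ t, HasDerivAt q (v t) t) (cκ : Continuous κ) {f : ℝ → ℝ}
    (hf : ∀ t ∈ Ioo 0 τ, f ‖q t‖ * ((conj (q t) * v t).re / ‖q t‖) = -κ t) :
    IntervalIntegrable f volume ‖q τ‖ ‖q 0‖ ∧
      ∫ r in ‖q τ‖..‖q 0‖, f r = ∫ t in (0 : ℝ)..τ, κ t := by
  have hcont : ContinuousOn (fun t ↦ ‖q t‖) (uIcc 0 τ) :=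
    (continuous_iff_continuousAt.2 fun t ↦ (hq t).continuousAt).norm.continuousOn
  have hIoo : Ioo (min 0 τ) (max 0 τ) = Ioo 0 τ := by
    rw [min_eq_left hτ.pos.le, max_eq_right hτ.pos.le]
  have hder : ∀ t ∈ Ioo (min 0 τ) (max 0 τ),
      HasDerivAt (fun t ↦ ‖q t‖) ((conj (q t) * v t).re / ‖q t‖) t := fun t ht ↦
    (hasDerivAt_norm_of_ne_zero (hq t)
      (hτ.ne_zero hq (Ioo_subset_Ico_self (hIoo ▸ ht)))).congr_deriv
      (by rw [Complex.inner, mul_comm])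
  have hnonpos : ∀ t ∈ Ioo (min 0 τ) (max 0 τ), (conj (q t) * v t).re / ‖q t‖ ≤ 0 := fun t ht ↦
    div_nonpos_of_nonpos_of_nonneg (hτ.approaching t (hIoo ▸ ht)).le (norm_nonneg _)
  have hcongr : EqOn (fun t ↦ -κ t) (fun t ↦ (f ∘ fun t ↦ ‖q t‖) t *
      ((conj (q t) * v t).re / ‖q t‖)) (Ioo 0 τ) := fun t ht ↦ (hf t ht).symm
  constructor
  · refine ((intervalIntegral.integrable_comp_mul_deriv_iff_of_deriv_nonpos hcont hder
      hnonpos).1 ?_).symm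
    exact (cκ.neg.intervalIntegrable 0 τ).congr_uIoo (by rwa [uIoo_of_le hτ.pos.le])
  · rw [intervalIntegral.integral_symm, ← intervalIntegral.integral_comp_mul_deriv_of_deriv_nonpos
      hcont hder hnonpos, ← intervalIntegral.integral_congr_uIoo
        (by rwa [uIoo_of_le hτ.pos.le]), intervalIntegral.integral_neg, neg_neg]

end SweptAngle

section RadialField

variable {B : ℝ → ℝ}

/-- The radial field `B(‖z‖)` of the unit disc, extended to the plane by its boundary value. -/
noncomputable def radialExtension (B : ℝ → ℝ) (z : ℂ) : ℝ := B (min ‖z‖ 1)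

theorem radialExtension_eq_of_norm_le_one {b : ℂ → ℝ}
    (hrad : ∀ z ∈ Metric.closedBall (0 : ℂ) 1, b z = B ‖z‖) {z : ℂ} (hz : ‖z‖ ≤ 1) :
    radialExtension B z = b z := by
  rw [hrad z (mem_closedBall_zero_iff.2 hz), radialExtension, min_eq_left hz]

theorem radialExtension_eq_of_norm_eq {z z' : ℂ} (h : ‖z‖ = ‖z'‖) :
    radialExtension B z = radialExtension B z' := by
  rw [radialExtension, radialExtension, h]

theorem exists_lipschitzWith_radialExtension {b : ℂ → ℝ}
    (hb : LocallyLipschitzOn (Metric.closedBall (0 : ℂ) 1) b)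
    (hrad : ∀ z ∈ Metric.closedBall (0 : ℂ) 1, b z = B ‖z‖) :
    ∃ K M : ℝ≥0, LipschitzWith K (radialExtension B) ∧ ∀ z, ‖radialExtension B z‖ ≤ M := by
  obtain ⟨K, hK⟩ := hb.exists_lipschitzOnWith_of_compact (isCompact_closedBall 0 1)
  obtain ⟨M, hM⟩ := (isCompact_closedBall (0 : ℂ) 1).exists_bound_of_continuousOn hK.continuousOn
  have hnorm (z : ℂ) : ‖((min ‖z‖ 1 : ℝ) : ℂ)‖ = min ‖z‖ 1 :=
    Complex.norm_of_nonneg (le_min (norm_nonneg z) zero_le_one)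
  have hmem (z : ℂ) : ((min ‖z‖ 1 : ℝ) : ℂ) ∈ Metric.closedBall (0 : ℂ) 1 :=
    mem_closedBall_zero_iff.2 ((hnorm z).trans_le (min_le_right _ _))
  have heq (z : ℂ) : radialExtension B z = b (min ‖z‖ 1 : ℝ) := by
    rw [hrad _ (hmem z), hnorm, radialExtension]
  refine ⟨K, M.toNNReal, LipschitzWith.of_dist_le_mul fun z z' ↦ ?_, fun z ↦ ?_⟩
  · rw [heq, heq]
    refine (hK.dist_le_mul _ (hmem z) _ (hmem z')).trans ?_
    gcongr
    rw [dist_eq_norm, ← Complex.ofReal_sub, Complex.norm_real, Real.norm_eq_abs, dist_eq_norm]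
    exact (abs_min_sub_min_le_max _ _ _ _).trans (by simpa using abs_norm_sub_norm_le z z')
  · rw [heq]
    exact (hM _ (hmem z)).trans (Real.le_coe_toNNReal M)

/-- The flux function `G` in terms of the squared radius. -/
noncomputable def fluxSq (B : ℝ → ℝ) (x : ℝ) : ℝ := ∫ σ in (0 : ℝ)..x, B (min √σ 1) / 2

/-- The square of `r dr/dt = ⟨q, v⟩` in terms of the squared radius `x = r²`, at angular momentum
`p` and speed `s`. -/
noncomputable def radialSq (B : ℝ → ℝ) (p s x : ℝ) : ℝ := s ^ 2 * x - (p - fluxSq B x) ^ 2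

/-- The time derivative of `⟨q, v⟩` in terms of the squared radius `x`, at angular momentum `p`
and speed `s`. It is also the derivative of `radialSq`. -/
noncomputable def radialForce (B : ℝ → ℝ) (p s x : ℝ) : ℝ :=
  s ^ 2 + B (min √x 1) * (p - fluxSq B x)

theorem fluxSq_zero : fluxSq B 0 = 0 := intervalIntegral.integral_same

theorem continuous_comp_min_sqrt (hB : Continuous (radialExtension B)) :
    Continuous fun σ ↦ B (min √σ 1) := by
  have : (fun σ ↦ B (min √σ 1)) = fun σ : ℝ ↦ radialExtension B (√σ : ℝ) := by
    funext σ
    rw [radialExtension, Complex.norm_of_nonneg (Real.sqrt_nonneg σ)]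
  rw [this]
  fun_prop

theorem hasDerivAt_fluxSq (hB : Continuous (radialExtension B)) (x : ℝ) :
    HasDerivAt (fluxSq B) (B (min √x 1) / 2) x :=
  (((continuous_comp_min_sqrt hB).div_const 2).integral_hasStrictDerivAt 0 x).hasDerivAt

theorem continuous_fluxSq (hB : Continuous (radialExtension B)) : Continuous (fluxSq B) :=
  continuous_iff_continuousAt.2 fun x ↦ (hasDerivAt_fluxSq hB x).continuousAt

theorem G_eq_fluxSq (hB : Continuous (radialExtension B)) {r : ℝ} (hr : r ∈ Icc (0 : ℝ) 1) :
    G B r = fluxSq B (r ^ 2) := by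
  have hsubst := intervalIntegral.integral_comp_mul_deriv (a := 0) (b := r)
    (fun τ _ ↦ hasDerivAt_pow 2 τ) (by fun_prop) ((continuous_comp_min_sqrt hB).div_const 2)
  rw [zero_pow two_ne_zero] at hsubst
  rw [fluxSq, ← hsubst, G]
  refine intervalIntegral.integral_congr fun τ hτ ↦ ?_
  rw [uIcc_of_le hr.1] at hτ
  simp only [Function.comp_apply, Real.sqrt_sq hτ.1, min_eq_left (hτ.2.trans hr.2)]
  ring

theorem hasDerivAt_radialSq (hB : Continuous (radialExtension B)) (p s x : ℝ) :
    HasDerivAt (radialSq B p s) (radialForce B p s x) x := by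
  refine (((hasDerivAt_id x).const_mul (s ^ 2)).sub
    (((hasDerivAt_fluxSq hB x).const_sub p).pow 2)).congr_deriv ?_
  rw [radialForce]
  ring

theorem continuous_radialSq (hB : Continuous (radialExtension B)) (p s : ℝ) :
    Continuous (radialSq B p s) :=
  continuous_iff_continuousAt.2 fun x ↦ (hasDerivAt_radialSq hB p s x).continuousAt

theorem continuous_radialForce (hB : Continuous (radialExtension B)) (p s : ℝ) :
    Continuous (radialForce B p s) :=
  continuous_const.add ((continuous_comp_min_sqrt hB).mul
    (continuous_const.sub (continuous_fluxSq hB)))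

theorem V_eq_sub_radialSq (hB : Continuous (radialExtension B)) (p s : ℝ) {r : ℝ}
    (hr : r ∈ Ioo (0 : ℝ) 1) :
    V B p r = s ^ 2 / 2 - radialSq B p s (r ^ 2) / (2 * r ^ 2) := by
  have := hr.1.ne'
  rw [V, G_eq_fluxSq hB (Ioo_subset_Icc_self hr), radialSq]
  field_simp
  ring

theorem V_eq_iff_radialSq_eq_zero (hB : Continuous (radialExtension B)) (p s : ℝ) {r : ℝ}
    (hr : r ∈ Ioo (0 : ℝ) 1) : V B p r = s ^ 2 / 2 ↔ radialSq B p s (r ^ 2) = 0 := by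
  rw [V_eq_sub_radialSq hB p s hr, sub_eq_self, div_eq_zero_iff]
  simp [hr.1.ne']

theorem deriv_V_of_radialSq_eq_zero (hB : Continuous (radialExtension B)) (p s : ℝ) {r : ℝ}
    (hr : r ∈ Ioo (0 : ℝ) 1) (h₀ : radialSq B p s (r ^ 2) = 0) :
    deriv (V B p) r = -(radialForce B p s (r ^ 2) / r) := by
  have hr₀ := hr.1.ne'
  have hd : HasDerivAt (fun r ↦ r ^ 2) (2 * r) r := by simpa using hasDerivAt_pow 2 r
  have h := (((hasDerivAt_radialSq hB p s (r ^ 2)).comp r hd).div (hd.const_mul 2)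
    (mul_ne_zero two_ne_zero (pow_ne_zero 2 hr₀))).const_sub (s ^ 2 / 2)
  have heq : V B p =ᶠ[𝓝 r]
      fun r ↦ s ^ 2 / 2 - (radialSq B p s ∘ fun r ↦ r ^ 2) r / (2 * r ^ 2) := by
    filter_upwards [Ioo_mem_nhds hr.1 hr.2] with x hx using V_eq_sub_radialSq hB p s hx
  refine (h.congr_of_eventuallyEq heq).deriv.trans ?_
  rw [Function.comp_apply, h₀]
  field_simp
  ring

theorem forall_radialSq_ne_zero (hB : Continuous (radialExtension B)) {p s r₀ : ℝ} (hr₀ : 0 ≤ r₀)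
    (hV : ∀ r ∈ Ioo r₀ 1, V B p r ≠ s ^ 2 / 2) :
    ∀ x ∈ Ioo (r₀ ^ 2) 1, radialSq B p s x ≠ 0 := by
  intro x hx hPx
  have hx₀ : 0 ≤ x := (sq_nonneg r₀).trans hx.1.le
  have hsqrt : √x ∈ Ioo r₀ 1 :=
    ⟨(Real.lt_sqrt hr₀).2 hx.1, (Real.sqrt_lt' one_pos).2 (by simpa using hx.2)⟩
  refine hV √x hsqrt ((V_eq_iff_radialSq_eq_zero hB p s ⟨hr₀.trans_lt hsqrt.1, hsqrt.2⟩).2 ?_)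
  rwa [Real.sq_sqrt hx₀]

theorem angleIntegrand_eq (hB : Continuous (radialExtension B)) (p s : ℝ) {r : ℝ}
    (hr : r ∈ Icc (0 : ℝ) 1) : angleIntegrand B p (s ^ 2 / 2) r
      = (p - fluxSq B (r ^ 2)) / (r * √(radialSq B p s (r ^ 2))) := by
  rw [angleIntegrand, G_eq_fluxSq hB hr, radialSq, mul_div_cancel₀ _ two_ne_zero]

/-- A motion in the extended radial field, of angular momentum `p` and speed `s`. -/
structure IsRadialMotion (B : ℝ → ℝ) (p s : ℝ) (q v : ℝ → ℂ) : Prop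
    extends IsMotion (radialExtension B) q v where
  speed : ∀ t, ‖v t‖ = s
  im_conj_mul : ∀ t, (conj (q t) * v t).im = p - fluxSq B (‖q t‖ ^ 2)

variable {p s : ℝ} {q v : ℝ → ℂ}

theorem IsMotion.isRadialMotion (h : IsMotion (radialExtension B) q v)
    (hB : Continuous (radialExtension B)) (hq : ‖q 0‖ = 1) :
    IsRadialMotion B (angularMomentum B (q 0) (v 0)) ‖v 0‖ q v := by
  refine ⟨h, h.norm_velocity, fun t ↦ ?_⟩
  have hd (t : ℝ) :
      HasDerivAt (fun t ↦ (conj (q t) * v t).im + fluxSq B (‖q t‖ ^ 2)) 0 t := by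
    refine ((h.hasDerivAt_im_conj_mul t).add
      ((hasDerivAt_fluxSq hB (‖q t‖ ^ 2)).comp t (h.velocity t).norm_sq)).congr_deriv ?_
    rw [radialExtension, Real.sqrt_sq (norm_nonneg _), Complex.inner, mul_comm (v t)]
    ring
  have hconst :=
    is_const_of_deriv_eq_zero (fun t ↦ (hd t).differentiableAt) (fun t ↦ (hd t).deriv) t 0
  rw [angularMomentum, tangentialVelocity, hq, G_eq_fluxSq hB ⟨zero_le_one, le_rfl⟩, div_one,
    one_mul, eq_sub_iff_add_eq, hconst, hq]

namespace IsRadialMotion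

theorem re_conj_mul_sq (h : IsRadialMotion B p s q v) (t : ℝ) :
    (conj (q t) * v t).re ^ 2 = radialSq B p s (‖q t‖ ^ 2) := by
  rw [radialSq, ← h.im_conj_mul, ← h.speed t, ← re_sq_add_im_sq_conj_mul, add_sub_cancel_right]

theorem hasDerivAt_re_conj_mul (h : IsRadialMotion B p s q v) (t : ℝ) :
    HasDerivAt (fun t ↦ (conj (q t) * v t).re) (radialForce B p s (‖q t‖ ^ 2)) t := by
  refine (h.toIsMotion.hasDerivAt_re_conj_mul t).congr_deriv ?_
  rw [h.speed, radialForce, h.im_conj_mul, radialExtension, Real.sqrt_sq (norm_nonneg _)]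

theorem exists_reachesPericenterAt (h : IsRadialMotion B p s q v)
    (hB : Continuous (radialExtension B)) {r₀ : ℝ} (hr₀ : 0 ≤ r₀) (hr₀q : r₀ < ‖q 0‖)
    (hP : radialSq B p s (r₀ ^ 2) = 0) (hF : 0 < radialForce B p s (r₀ ^ 2))
    (hne : ∀ x ∈ Ioo (r₀ ^ 2) (‖q 0‖ ^ 2), radialSq B p s x ≠ 0)
    (hin : (conj (q 0) * v 0).re < 0 ∨
      (conj (q 0) * v 0).re = 0 ∧ radialForce B p s (‖q 0‖ ^ 2) < 0) :
    ∃ τ, ReachesPericenterAt q v τ ∧ ‖q τ‖ = r₀ := by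
  obtain ⟨τ, hτ, hqτ, hwτ, hneg⟩ := exists_fall_time
    (u := fun t ↦ ‖q t‖ ^ 2) (w := fun t ↦ 2 * (conj (q t) * v t).re) (a := r₀ ^ 2)
    (P := fun x ↦ 4 * radialSq B p s x) (F := fun x ↦ 2 * radialForce B p s x)
    (fun t ↦ by simpa only [Complex.inner, mul_comm (v t)] using (h.velocity t).norm_sq)
    (fun t ↦ (h.hasDerivAt_re_conj_mul t).const_mul 2)
    (fun t ↦ by rw [mul_pow, h.re_conj_mul_sq]; norm_num)
    ((continuous_radialSq hB p s).const_mul 4) ((continuous_radialForce hB p s).const_mul 2)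
    (pow_lt_pow_left₀ hr₀q hr₀ two_ne_zero) (by rw [hP, mul_zero]) (mul_pos two_pos hF)
    (fun x hx ↦ mul_ne_zero four_ne_zero (hne x hx))
    (hin.imp (mul_neg_of_pos_of_neg two_pos)
      (And.imp (mul_eq_zero_of_right 2) (mul_neg_of_pos_of_neg two_pos)))
  exact ⟨τ, ⟨hτ, fun t ht ↦ by linarith [hneg t ht], by linarith⟩,
    (sq_eq_sq₀ (norm_nonneg _) hr₀).1 hqτ⟩

theorem enters (h : IsRadialMotion B p s q v) (hq : ‖q 0‖ = 1)
    (henter : radialVelocity (q 0) (v 0) < 0 ∨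
      (radialVelocity (q 0) (v 0) = 0 ∧ B 1 / tangentialVelocity (q 0) (v 0) < -1)) :
    (conj (q 0) * v 0).re < 0 ∨
      (conj (q 0) * v 0).re = 0 ∧ radialForce B p s (‖q 0‖ ^ 2) < 0 := by
  rw [radialVelocity, tangentialVelocity, hq, div_one, div_one] at henter
  refine henter.imp_right fun ⟨hw, hl⟩ ↦ ⟨hw, ?_⟩
  have hsq : s ^ 2 = (conj (q 0) * v 0).im ^ 2 := by
    have := re_sq_add_im_sq_conj_mul (q 0) (v 0)
    rw [hw, h.speed, hq] at this
    linarith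
  rw [radialForce, ← h.im_conj_mul, hsq, hq, one_pow, Real.sqrt_one, min_self]
  generalize (conj (q 0) * v 0).im = l at hl
  have hl₀ : l ≠ 0 := fun hl₀ ↦ by norm_num [hl₀] at hl
  calc l ^ 2 + B 1 * l = l ^ 2 * (1 + B 1 / l) := by field_simp
    _ < 0 := mul_neg_of_pos_of_neg (sq_pos_of_ne_zero hl₀) (by linarith)

-- `dθ/dr = (dθ/dt) / (dr/dt)`
theorem angleIntegrand_mul_deriv_norm (h : IsRadialMotion B p s q v)
    (hB : Continuous (radialExtension B)) {t κ : ℝ} (hq₀ : q t ≠ 0) (hq₁ : ‖q t‖ ≤ 1)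
    (hw : (conj (q t) * v t).re < 0) (hκ : (conj (q t) * v t).im = κ * ‖q t‖ ^ 2) :
    angleIntegrand B p (s ^ 2 / 2) ‖q t‖ * ((conj (q t) * v t).re / ‖q t‖) = -κ := by
  have hn := norm_ne_zero_iff.2 hq₀
  have hw₀ := hw.ne
  rw [angleIntegrand_eq hB p s ⟨norm_nonneg _, hq₁⟩, ← h.im_conj_mul, ← h.re_conj_mul_sq,
    Real.sqrt_sq_eq_abs, abs_of_neg hw, hκ]
  field_simp

theorem integral_angleIntegrand_eq (h : IsRadialMotion B p s q v)
    (hB : Continuous (radialExtension B)) {τ : ℝ} (hτ : ReachesPericenterAt q v τ)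
    (hq : ‖q 0‖ ≤ 1) {κ : ℝ → ℝ} (cκ : Continuous κ)
    (hκ : ∀ t ∈ Ico 0 τ, (conj (q t) * v t).im = κ t * ‖q t‖ ^ 2) :
    IntervalIntegrable (angleIntegrand B p (s ^ 2 / 2)) volume ‖q τ‖ ‖q 0‖ ∧
      ∫ r in ‖q τ‖..‖q 0‖, angleIntegrand B p (s ^ 2 / 2) r = ∫ t in (0 : ℝ)..τ, κ t := by
  refine hτ.integral_radius_eq h.velocity cκ fun t ht ↦ ?_
  have hle : ‖q t‖ ≤ ‖q 0‖ := (hτ.strictAntiOn_norm h.velocity).antitoneOn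
    (left_mem_Icc.2 hτ.pos.le) (Ioo_subset_Icc_self ht) ht.1.le
  exact h.angleIntegrand_mul_deriv_norm hB (hτ.ne_zero h.velocity (Ioo_subset_Ico_self ht))
    (hle.trans hq) (hτ.approaching t ht) (hκ t (Ioo_subset_Ico_self ht))

end IsRadialMotion

end RadialField

section Scattering

/-- A trajectory with initial data `(q₁, v₁)` that crosses the unit disc during `(0, T)` and leaves
it for good at time `T`, with its initial speed. -/
structure IsScatteringTrajectory (b : ℂ → ℝ) (U : Set ℂ) (q₁ v₁ : ℂ) (T : ℝ) (q v : ℝ → ℂ) :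
    Prop where
  trajectory : IsTrajectoryOn b U T q v
  position_zero : q 0 = q₁
  velocity_zero : v 0 = v₁
  escapes : EscapesAt q v T
  norm_velocity : ‖v T‖ = ‖v₁‖

variable {B k : ℝ → ℝ} {b : ℂ → ℝ} {U : Set ℂ} {q₁ v₁ : ℂ} {p r₀ rs : ℝ}

theorem IsScatteringTrajectory.unique {T T' : ℝ} {q v q' v' : ℝ → ℂ}
    (h : IsScatteringTrajectory b U q₁ v₁ T q v) (hb : LocallyLipschitzOn U b)
    (h' : IsTrajectoryOn b U T' q' v') (hq : q' 0 = q₁) (hv : v' 0 = v₁) :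
    ∀ t ∈ Icc 0 (min T T'), q' t = q t ∧ v' t = v t := fun _ ht ↦
  Prod.ext_iff.1 <| (h'.mono (min_le_right _ _)).eqOn hb (h.trajectory.mono (min_le_left _ _))
    (hq.trans h.position_zero.symm) (hv.trans h.velocity_zero.symm) ht

-- `k` is the angular velocity as a function of the squared radius.
theorem exists_isScatteringTrajectory (hdisc : Metric.closedBall (0 : ℂ) 1 ⊆ U)
    (hb : LocallyLipschitzOn U b) (hrad : ∀ z ∈ Metric.closedBall (0 : ℂ) 1, b z = B ‖z‖)
    (hq₁ : ‖q₁‖ = 1) (hv₁ : v₁ ≠ 0)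
    (henter : radialVelocity q₁ v₁ < 0 ∨
      (radialVelocity q₁ v₁ = 0 ∧ B 1 / tangentialVelocity q₁ v₁ < -1))
    (hp : p = angularMomentum B q₁ v₁) (hr₀ : r₀ ∈ Ico 0 1)
    (hP : radialSq B p ‖v₁‖ (r₀ ^ 2) = 0) (hF : 0 < radialForce B p ‖v₁‖ (r₀ ^ 2))
    (hne : ∀ x ∈ Ioo (r₀ ^ 2) 1, radialSq B p ‖v₁‖ x ≠ 0) (ck : Continuous k)
    (hk : ∀ x, r₀ ^ 2 ≤ x → p - fluxSq B x = k x * x) :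
    ∃ T q v, IsScatteringTrajectory b U q₁ v₁ T q v ∧ (∀ t ∈ Icc 0 T, r₀ ≤ ‖q t‖) ∧
      (∃ t ∈ Ioo 0 T, ‖q t‖ = r₀) ∧
      IntervalIntegrable (angleIntegrand B p (energy v₁)) volume r₀ 1 ∧
      conj v₁ * v T = (‖v₁‖ ^ 2 - 2 * ((p - fluxSq B (r₀ ^ 2)) * k (r₀ ^ 2)) : ℝ) *
        Complex.exp ((2 * (∫ r in r₀..1, angleIntegrand B p (energy v₁) r)
          - 2 * orientedAngle q₁ v₁ : ℝ) * Complex.I) := by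
  obtain ⟨K, M, hK, hM⟩ := exists_lipschitzWith_radialExtension (hb.mono hdisc) hrad
  obtain ⟨q, v, hmotion, rfl, rfl⟩ := IsMotion.exists_of_lipschitzWith hK hM q₁ v₁
  have h := hmotion.isRadialMotion hK.continuous hq₁
  rw [← hp] at h
  obtain ⟨τ, hτ, hqτ⟩ := h.exists_reachesPericenterAt hK.continuous hr₀.1 (hq₁ ▸ hr₀.2) hP hF
    (by rwa [hq₁, one_pow]) (h.enters hq₁ henter)
  obtain ⟨E, hE, hvE⟩ := hmotion.exists_isReflectionSymmetricAt hK.locallyLipschitz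
    (fun _ _ ↦ radialExtension_eq_of_norm_eq)
    (norm_ne_zero_iff.1 ((h.speed τ).trans_ne (norm_ne_zero_iff.2 hv₁))) hτ.perpendicular
  have hle (t : ℝ) (ht : t ∈ Icc 0 (2 * τ)) : ‖q t‖ ≤ 1 :=
    hq₁ ▸ hE.norm_le_norm_zero hτ h.velocity ht
  have hge (t : ℝ) (ht : t ∈ Icc 0 (2 * τ)) : r₀ ≤ ‖q t‖ :=
    hqτ ▸ hE.norm_pericenter_le hτ h.velocity ht
  have hκ (t : ℝ) (ht : t ∈ Ico 0 τ) :
      (conj (q t) * v t).im = k (‖q t‖ ^ 2) * ‖q t‖ ^ 2 := by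
    rw [h.im_conj_mul]
    exact hk _ (pow_le_pow_left₀ hr₀.1 (hge t ⟨ht.1, by linarith [ht.2, hτ.pos]⟩) 2)
  have cκ : Continuous fun t ↦ k (‖q t‖ ^ 2) := ck.comp (hmotion.continuous_position.norm.pow 2)
  obtain ⟨hint, hval⟩ := h.integral_angleIntegrand_eq hK.continuous hτ hq₁.le cκ hκ
  have hangle := hE.conj_velocity_mul_velocity hvE hτ h.velocity hmotion.continuous_velocity
    (h.speed τ) hv₁ cκ hκ
  rw [hqτ, hq₁] at hint hval
  rw [← hval, h.im_conj_mul, hqτ] at hangle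
  exact ⟨2 * τ, q, v, ⟨hmotion.isTrajectoryOn
      (fun t ht ↦ hdisc (mem_closedBall_zero_iff.2 (hle t ht)))
      (fun t ht ↦ radialExtension_eq_of_norm_le_one hrad (hle t ht)), rfl, rfl,
    hE.escapesAt hτ h.velocity hmotion.continuous_velocity hq₁ hv₁, h.speed _⟩, hge,
    ⟨τ, ⟨hτ.pos, by linarith [hτ.pos]⟩, hqτ⟩, hint, hangle⟩

theorem arg_ofReal_mul_exp_coe_angle {r : ℝ} (hr : 0 < r) (θ : ℝ) :
    (Complex.arg (r * Complex.exp (θ * Complex.I)) : Real.Angle) = θ := by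
  rw [Complex.exp_mul_I]
  have := Complex.arg_mul_cos_add_sin_mul_I_coe_angle hr (θ : Real.Angle)
  simpa using this

theorem exists_isScatteringTrajectory_of_turningPoint (hdisc : Metric.closedBall (0 : ℂ) 1 ⊆ U)
    (hb : LocallyLipschitzOn U b) (hrad : ∀ z ∈ Metric.closedBall (0 : ℂ) 1, b z = B ‖z‖)
    (hq₁ : ‖q₁‖ = 1) (hv₁ : v₁ ≠ 0)
    (henter : radialVelocity q₁ v₁ < 0 ∨
      (radialVelocity q₁ v₁ = 0 ∧ B 1 / tangentialVelocity q₁ v₁ < -1))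
    (hp : p = angularMomentum B q₁ v₁)
    (hrs : IsOutermostTurningPoint B p (energy v₁) rs) (hder : deriv (V B p) rs < 0) :
    ∃ T q v, IsScatteringTrajectory b U q₁ v₁ T q v ∧ (∀ t ∈ Icc 0 T, q t ≠ 0) ∧
      IntervalIntegrable (angleIntegrand B p (energy v₁)) volume rs 1 ∧
      (orientedAngle v₁ (v T) : Real.Angle) =
        ((2 * (∫ r in rs..1, angleIntegrand B p (energy v₁) r) + Real.pi
          - 2 * orientedAngle q₁ v₁ : ℝ) : Real.Angle) := by
  obtain ⟨K, M, hK, -⟩ := exists_lipschitzWith_radialExtension (hb.mono hdisc) hrad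
  have hB := hK.continuous
  have hs : 0 < ‖v₁‖ ^ 2 := pow_pos (norm_pos_iff.2 hv₁) 2
  have hr : rs ∈ Ioo (0 : ℝ) 1 := hrs.1.1
  have hr₂ : 0 < rs ^ 2 := pow_pos hr.1 2
  have hP : radialSq B p ‖v₁‖ (rs ^ 2) = 0 :=
    (V_eq_iff_radialSq_eq_zero hB p ‖v₁‖ hr).1 hrs.1.2
  have hF : 0 < radialForce B p ‖v₁‖ (rs ^ 2) := by
    rw [deriv_V_of_radialSq_eq_zero hB p ‖v₁‖ hr hP, neg_lt_zero] at hder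
    exact (div_pos_iff_of_pos_right hr.1).1 hder
  have hne : ∀ x ∈ Ioo (rs ^ 2) 1, radialSq B p ‖v₁‖ x ≠ 0 :=
    forall_radialSq_ne_zero hB hr.1.le fun r hr' hVr ↦
      (hrs.2 ⟨⟨hr.1.trans hr'.1, hr'.2⟩, hVr⟩).not_gt hr'.1
  obtain ⟨T, q, v, h, hge, -, hint, hangle⟩ := exists_isScatteringTrajectory
    (k := fun x ↦ (p - fluxSq B x) / max x (rs ^ 2)) hdisc hb hrad hq₁ hv₁ henter hp
    ⟨hr.1.le, hr.2⟩ hP hF hne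
    ((continuous_const.sub (continuous_fluxSq hB)).div (continuous_id.max continuous_const)
      fun x ↦ (hr₂.trans_le (le_max_right _ _)).ne')
    (fun x hx ↦ by rw [max_eq_left hx, div_mul_cancel₀ _ (hr₂.trans_le hx).ne'])
  refine ⟨T, q, v, h, fun t ht ↦ norm_pos_iff.1 (hr.1.trans_le (hge t ht)), hint, ?_⟩
  have hconst : ‖v₁‖ ^ 2 - 2 * ((p - fluxSq B (rs ^ 2)) *
      ((p - fluxSq B (rs ^ 2)) / max (rs ^ 2) (rs ^ 2))) = -‖v₁‖ ^ 2 := by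
    rw [radialSq, sub_eq_zero] at hP
    rw [max_self, ← mul_div_assoc, ← sq, ← hP, mul_div_cancel_right₀ _ hr₂.ne']
    ring
  rw [hconst] at hangle
  rw [orientedAngle, hangle, Complex.ofReal_neg, neg_mul, Complex.arg_neg_coe_angle
    (mul_ne_zero (Complex.ofReal_ne_zero.2 hs.ne') (Complex.exp_ne_zero _)),
    arg_ofReal_mul_exp_coe_angle hs, ← Real.Angle.coe_add, sub_add_eq_add_sub]

theorem exists_isScatteringTrajectory_through_origin (hdisc : Metric.closedBall (0 : ℂ) 1 ⊆ U)
    (hb : LocallyLipschitzOn U b) (hrad : ∀ z ∈ Metric.closedBall (0 : ℂ) 1, b z = B ‖z‖)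
    (hq₁ : ‖q₁‖ = 1) (hv₁ : v₁ ≠ 0)
    (henter : radialVelocity q₁ v₁ < 0 ∨
      (radialVelocity q₁ v₁ = 0 ∧ B 1 / tangentialVelocity q₁ v₁ < -1))
    (hp : angularMomentum B q₁ v₁ = 0)
    (hV : ∀ r ∈ Ioo (0 : ℝ) 1, V B 0 r ≠ energy v₁) :
    ∃ T q v, IsScatteringTrajectory b U q₁ v₁ T q v ∧ (∃ t ∈ Ioo 0 T, q t = 0) ∧
      IntervalIntegrable (angleIntegrand B 0 (energy v₁)) volume 0 1 ∧
      (orientedAngle v₁ (v T) : Real.Angle) =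
        ((2 * (∫ r in (0 : ℝ)..1, angleIntegrand B 0 (energy v₁) r)
          - 2 * orientedAngle q₁ v₁ : ℝ) : Real.Angle) := by
  obtain ⟨K, M, hK, -⟩ := exists_lipschitzWith_radialExtension (hb.mono hdisc) hrad
  have hB := hK.continuous
  have hs : 0 < ‖v₁‖ ^ 2 := pow_pos (norm_pos_iff.2 hv₁) 2
  have hsq : (0 : ℝ) ^ 2 = 0 := zero_pow two_ne_zero
  have hdslope : Continuous (dslope (fluxSq B) 0) :=
    continuousOn_univ.1 <| (continuousOn_dslope univ_mem).2
      ⟨(continuous_fluxSq hB).continuousOn, (hasDerivAt_fluxSq hB 0).differentiableAt⟩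
  obtain ⟨T, q, v, h, -, ⟨t, ht, hqt⟩, hint, hangle⟩ := exists_isScatteringTrajectory
    (k := fun x ↦ -dslope (fluxSq B) 0 x) hdisc hb hrad hq₁ hv₁ henter hp.symm
    ⟨le_rfl, one_pos⟩ (by simp [radialSq, fluxSq_zero])
    (by simpa [radialForce, fluxSq_zero] using hs)
    (forall_radialSq_ne_zero hB le_rfl hV) hdslope.neg
    (fun x _ ↦ by
      have := sub_smul_dslope (fluxSq B) 0 x
      rw [sub_zero, fluxSq_zero, sub_zero, smul_eq_mul] at this
      rw [← this, zero_sub, neg_mul, mul_comm])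
  refine ⟨T, q, v, h, ⟨t, ht, norm_eq_zero.1 hqt⟩, hint, ?_⟩
  rw [hsq, fluxSq_zero, sub_zero, zero_mul, mul_zero, sub_zero] at hangle
  rw [orientedAngle, hangle, arg_ofReal_mul_exp_coe_angle hs]

end Scattering

end MagneticScattering

open MagneticScattering in
theorem theorem2p6
    -- the radial field, with a locally Lipschitz extension `b` around the closed unit disc
    (B : ℝ → ℝ) (b : ℂ → ℝ) (U : Set ℂ) (hU : IsOpen U)
    (hdisc : Metric.closedBall (0 : ℂ) 1 ⊆ U) (hb : LocallyLipschitzOn U b)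
    (hrad : ∀ z ∈ Metric.closedBall (0 : ℂ) 1, b z = B ‖z‖)
    -- the initial data: on the unit circle, entering the disc
    (q₁ v₁ : ℂ) (hq₁ : ‖q₁‖ = 1) (hv₁ : v₁ ≠ 0)
    (henter : radialVelocity q₁ v₁ < 0 ∨
      (radialVelocity q₁ v₁ = 0 ∧ B 1 / tangentialVelocity q₁ v₁ < -1))
    (p H₀ γ : ℝ) (hp : p = angularMomentum B q₁ v₁) (hH₀ : H₀ = energy v₁)
    (hγ : γ = orientedAngle q₁ v₁)
    (hV : (∃ rs, IsOutermostTurningPoint B p H₀ rs ∧ deriv (V B p) rs < 0) ∨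
      (p = 0 ∧ ∀ r ∈ Set.Ioo (0 : ℝ) 1, V B p r ≠ H₀)) :
    ∃ (T : ℝ) (q v : ℝ → ℂ),
      -- the trajectory with these initial data, and its uniqueness
      IsTrajectoryOn b U T q v ∧ q 0 = q₁ ∧ v 0 = v₁ ∧
      (∀ (T' : ℝ) (q' v' : ℝ → ℂ), IsTrajectoryOn b U T' q' v' → q' 0 = q₁ → v' 0 = v₁ →
        ∀ t ∈ Set.Icc 0 (min T T'), q' t = q t ∧ v' t = v t) ∧
      -- it escapes at the time `T`, with velocity `v T`
      EscapesAt q v T ∧ ‖v T‖ = ‖v₁‖ ∧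
      -- the scattering angle, modulo `2π`
      ((∃ rs, IsOutermostTurningPoint B p H₀ rs ∧ deriv (V B p) rs < 0 ∧
          (∀ t ∈ Set.Icc 0 T, q t ≠ 0) ∧
          IntervalIntegrable (angleIntegrand B p H₀) MeasureTheory.volume rs 1 ∧
          (orientedAngle v₁ (v T) : Real.Angle) =
            ((2 * (∫ r in rs..1, angleIntegrand B p H₀ r) + Real.pi - 2 * γ : ℝ) : Real.Angle)) ∨
        (p = 0 ∧ (∀ r ∈ Set.Ioo (0 : ℝ) 1, V B p r ≠ H₀) ∧
          (∃ t ∈ Set.Ioo 0 T, q t = 0) ∧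
          IntervalIntegrable (angleIntegrand B 0 H₀) MeasureTheory.volume 0 1 ∧
          (orientedAngle v₁ (v T) : Real.Angle) =
            ((2 * (∫ r in (0 : ℝ)..1, angleIntegrand B 0 H₀ r) - 2 * γ : ℝ) : Real.Angle))) := by
  subst hH₀ hγ
  rcases hV with ⟨rs, hrs, hder⟩ | ⟨hp₀, hV⟩
  · obtain ⟨T, q, v, h, hne, hint, hangle⟩ :=
      exists_isScatteringTrajectory_of_turningPoint hdisc hb hrad hq₁ hv₁ henter hp hrs hder
    exact ⟨T, q, v, h.trajectory, h.position_zero, h.velocity_zero,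
      fun _ _ _ h' hq hv ↦ h.unique hb h' hq hv, h.escapes, h.norm_velocity,
      Or.inl ⟨rs, hrs, hder, hne, hint, hangle⟩⟩
  · subst hp₀
    obtain ⟨T, q, v, h, hzero, hint, hangle⟩ :=
      exists_isScatteringTrajectory_through_origin hdisc hb hrad hq₁ hv₁ henter hp.symm hV
    exact ⟨T, q, v, h.trajectory, h.position_zero, h.velocity_zero,
      fun _ _ _ h' hq hv ↦ h.unique hb h' hq hv, h.escapes, h.norm_velocity,
      Or.inr ⟨rfl, hV, hzero, hint, hangle⟩⟩
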